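/- Consider episodic Markov decision processes with a finite set $\mathcal S$ of $S$ states, a finite set $\mathcal A$ of $A$ actions, horizon $H$, initial distribution $\rho$, transition function $P^\star(s,a,s')$ and $n$ reward functions $r_i:\mathcal S\times\mathcal A\to[0,1]$. For a transition function $P$ and a randomized non-stationary policy $\pi=(\pi_1,\dots,\pi_H)$ let $V^\pi(r_i;P)=\mathbb E_{\pi,P}\big[\sum_{h=1}^H r_i(s_h,a_h)\mid s_1\sim\rho\big]$ and let $\mathrm{NW}(\pi;P)=\prod_{i=1}^n V^\pi(r_i;P)$ be the Nash social welfare. Let $\pi^\star\in\operatorname{argmax}_\pi \mathrm{NW}(\pi;P^\star)$. The algorithm UCRL-F for the Nash social welfare knows $\rho$ and $r_1,\dots,r_n$ but not $P^\star$, and has a parameter $\delta\in(0,1)$. At the start of episode $t=1,2,\dots$ let $N_t(s,a)$ be the number of pairs $(t',h)$ with $t'<t$, $1\le h\le H-1$ and $(s_{t',h},a_{t',h})=(s,a)$, let $N_t(s,a,s')$ be the number of those with $s_{t',h+1}=s'$ as well, and let $\widehat P_t(s,a,s')=N_t(s,a,s')/N_t(s,a)$ if $N_t(s,a)>0$ and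 $\widehat P_t(s,a,s')=1/S$ otherwise. Let $$C_t=\Big\{P:\ \|P(s,a,\cdot)-\widehat P_t(s,a,\cdot)\|_1\le\sqrt{\tfrac{4S\log(SAt/\delta)}{\max\{1,N_t(s,a)\}}}\ \text{ for all } s,a\Big\}.$$ The algorithm computes $\widetilde P_t\in\operatorname{argmax}_{P\in C_t}\max_\pi\mathrm{NW}(\pi;P)$ and $\pi_t\in\operatorname{argmax}_\pi\mathrm{NW}(\pi;\widetilde P_t)$ (ties broken by an arbitrary rule depending on the history), and plays $\pi_t$ in episode $t$. Then there is a universal constant $C>0$ such that for all $S,A,H,n,T$, all $\delta\in(0,1)$, all such $\rho,P^\star,r_1,\dots,r_n$ and all ways of breaking ties, with probability at least $1-\delta$, $$\mathrm{Reg}_{\mathrm{NW}}(T)=\sum_{t=1}^T\big(\mathrm{NW}(\pi^\star;P^\star)-\mathrm{NW}(\pi_t;P^\star)\big)\ \le\ C\,n\,H^{n+1}S\sqrt{AT}\,\sqrt{\log(SAT/\delta)} .$$ In particular $\mathrm{Reg}_{\mathrm{NW}}(T)=\tilde O\big(nH^{n+1}S\sqrt{AT}\big)$ with probability at least $1-\delta$.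 -/

import Mathlib

/-! Episodic Markov decision processes with several reward functions, the Nash social welfare of a
policy, and the optimistic algorithm UCRL-F for the Nash social welfare objective. -/

namespace FairRL

/-- A (time-homogeneous) transition function: `P s a s'` is the probability of moving to `s'` when
action `a` is played in state `s`. -/
abbrev Transition (S A : Type*) [Fintype S] := S → A → stdSimplex ℝ S

/-- A randomized, non-stationary Markov policy for horizon `H`: `π h s a` is the probability of
playing action `a` in state `s` at time-step `h`. Time-steps are numbered `0, …, H - 1`. -/
abbrev Policy (S A : Type*) [Fintype A] (H : ℕ) := Fin H → S → stdSimplex ℝ A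

/-- The state-action pairs met during one episode of length `H`. -/
abbrev Episode (S A : Type*) (H : ℕ) := Fin H → S × A

variable {S A : Type*} [Fintype S] [Fintype A] [DecidableEq S] [DecidableEq A] {H n : ℕ}

/-- The probability of reaching the state of time-step `h`, given what happened before `h`:
the initial distribution `ρ` at the first time-step, the transition function afterwards. -/
noncomputable def arrivalProb (ρ : stdSimplex ℝ S) (P : Transition S A) (τ : Episode S A H)
    (h : Fin H) : ℝ :=
  if (h : ℕ) = 0 then ρ.1 (τ h).1
  else
    let prev : Fin H := ⟨h - 1, lt_of_le_of_lt (Nat.sub_le _ _) h.2⟩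
    (P (τ prev).1 (τ prev).2).1 (τ h).1

/-- The probability of the episode `τ` when policy `π` is played in the MDP with initial
distribution `ρ` and transition function `P`. -/
noncomputable def episodeProb (ρ : stdSimplex ℝ S) (P : Transition S A) (π : Policy S A H)
    (τ : Episode S A H) : ℝ :=
  ∏ h : Fin H, arrivalProb ρ P τ h * (π h (τ h).1).1 (τ h).2

/-- The value function `V^π(ρ; r; P)`: the expected sum of rewards over an episode. -/
noncomputable def value (ρ : stdSimplex ℝ S) (r : S → A → ℝ) (P : Transition S A)
    (π : Policy S A H) : ℝ :=
  ∑ τ : Episode S A H, episodeProb ρ P π τ * ∑ h : Fin H, r (τ h).1 (τ h).2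

/-- The Nash social welfare `NW(π; P)` of `n` agents with reward functions `r i`. -/
noncomputable def nashWelfare (ρ : stdSimplex ℝ S) (r : Fin n → S → A → ℝ) (P : Transition S A)
    (π : Policy S A H) : ℝ :=
  ∏ i : Fin n, value ρ (r i) P π

/-- The number of visits to `(s, a)` in the `t` completed episodes of `hist` after which a
transition was observed, i.e. at a time-step other than the last one of its episode. -/
def visitCount {t : ℕ} (hist : Fin t → Episode S A H) (s : S) (a : A) : ℕ :=
  ∑ k : Fin t, ∑ h : Fin H, if (h : ℕ) + 1 < H ∧ hist k h = (s, a) then 1 else 0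

/-- The number of transitions from `(s, a)` to `s'` in the `t` completed episodes of `hist`. -/
def transitionCount {t : ℕ} (hist : Fin t → Episode S A H) (s : S) (a : A) (s' : S) : ℕ :=
  ∑ k : Fin t, ∑ h : Fin H,
    if hh : (h : ℕ) + 1 < H then
      if hist k h = (s, a) ∧ (hist k ⟨h + 1, hh⟩).1 = s' then 1 else 0
    else 0

/-- The empirical transition function; the uniform distribution at pairs without any data. -/
noncomputable def empirical {t : ℕ} (hist : Fin t → Episode S A H) (s : S) (a : A) (s' : S) : ℝ :=
  if visitCount hist s a = 0 then 1 / (Fintype.card S : ℝ)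
  else (transitionCount hist s a s' : ℝ) / (visitCount hist s a : ℝ)

/-- The confidence set used in episode number `t + 1`, where `hist` holds the `t` episodes
completed so far: all transition functions whose `ℓ¹`-distance to the empirical one is at most
`√(4 S log(S A (t + 1) / δ) / max {1, N(s, a)})` at every state-action pair. -/
def confidenceSet (δ : ℝ) {t : ℕ} (hist : Fin t → Episode S A H) : Set (Transition S A) :=
  {P | ∀ s a, ∑ s' : S, |(P s a).1 s' - empirical hist s a s'| ≤
    Real.sqrt (4 * (Fintype.card S : ℝ) *
        Real.log ((Fintype.card S : ℝ) * (Fintype.card A : ℝ) * ((t : ℝ) + 1) / δ) /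
      max 1 (visitCount hist s a : ℝ))}

/-- A planning rule: what the learner computes at the start of episode number `t + 1` from the `t`
episodes completed so far, namely a transition function and the policy it then plays. -/
abbrev Planner (S A : Type*) [Fintype S] [Fintype A] (H : ℕ) :=
  (t : ℕ) → (Fin t → Episode S A H) → Transition S A × Policy S A H

/-- `alg` is UCRL-F for the Nash social welfare with confidence parameter `δ`: at the start of each
episode it computes
`P̃ ∈ argmax_{P ∈ C} max_π NW(π; P)` and `π̃ ∈ argmax_π NW(π; P̃)`,
where `C` is the current confidence set. Ties may be broken in any way. -/
def IsUCRLNash (ρ : stdSimplex ℝ S) (r : Fin n → S → A → ℝ) (δ : ℝ) (alg : Planner S A H) : Prop :=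
  ∀ (t : ℕ) (hist : Fin t → Episode S A H),
    (alg t hist).1 ∈ confidenceSet δ hist ∧
    IsMaxOn (fun P : Transition S A => ⨆ π : Policy S A H, nashWelfare ρ r P π)
      (confidenceSet δ hist) (alg t hist).1 ∧
    IsMaxOn (fun π : Policy S A H => nashWelfare ρ r (alg t hist).1 π) Set.univ (alg t hist).2

/-- The policy that `alg` plays in episode `t` of the run `ω`; it depends on the earlier episodes
only. -/
def playedPolicy (alg : Planner S A H) {T : ℕ} (ω : Fin T → Episode S A H) (t : Fin T) :
    Policy S A H :=
  (alg t (fun k : Fin t => ω (Fin.castLE t.2.le k))).2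

/-- The probability of the run `ω` of `T` episodes when `alg` interacts with the MDP with initial
distribution `ρ` and transition function `P`. -/
noncomputable def runProb (ρ : stdSimplex ℝ S) (P : Transition S A) (alg : Planner S A H) {T : ℕ}
    (ω : Fin T → Episode S A H) : ℝ :=
  ∏ t : Fin T, episodeProb ρ P (playedPolicy alg ω t) (ω t)

open Classical in
/-- The probability that the run of `T` episodes lies in `E`. -/
noncomputable def probRun (ρ : stdSimplex ℝ S) (P : Transition S A) (alg : Planner S A H) (T : ℕ)
    (E : Set (Fin T → Episode S A H)) : ℝ :=
  ∑ ω : Fin T → Episode S A H, if ω ∈ E then runProb ρ P alg ω else 0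

/-- The regret `∑_t (NW(π⋆) - NW(π_t))` of `alg` on the run `ω`, against the policy `πstar`. -/
noncomputable def regret (ρ : stdSimplex ℝ S) (r : Fin n → S → A → ℝ) (P : Transition S A)
    (πstar : Policy S A H) (alg : Planner S A H) {T : ℕ} (ω : Fin T → Episode S A H) : ℝ :=
  ∑ t : Fin T, (nashWelfare ρ r P πstar - nashWelfare ρ r P (playedPolicy alg ω t))

end FairRL

namespace FairRL

/-- The weight of a sequence under a product of factors, each of which may depend on the past. -/
noncomputable def seqProb {X : Type*} (k : (t : ℕ) → (Fin t → X) → X → ℝ) (T : ℕ)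
    (ω : Fin T → X) : ℝ :=
  ∏ t : Fin T, k t (fun j : Fin t => ω (Fin.castLE t.2.le j)) (ω t)

section Sequences

variable {X : Type*}

theorem sum_pi_fin_succ [Fintype X] {T : ℕ} (f : (Fin (T + 1) → X) → ℝ) :
    ∑ ω, f ω = ∑ ω : Fin T → X, ∑ x, f (Fin.snoc (α := fun _ => X) ω x) := by
  rw [← (Fin.snocEquiv (fun _ : Fin (T + 1) => X)).sum_comp f, Fintype.sum_prod_type_right]
  rfl

theorem snoc_comp_castLE {T t : ℕ} (h : t ≤ T) (ω : Fin T → X) (x : X) :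
    (fun j : Fin t => (Fin.snoc (α := fun _ => X) ω x : Fin (T + 1) → X)
      (Fin.castLE (h.trans T.le_succ) j)) = fun j => ω (Fin.castLE h j) := by
  funext j
  exact Fin.snoc_castSucc (α := fun _ => X) x ω (Fin.castLE h j)

theorem seqProb_snoc (k : (t : ℕ) → (Fin t → X) → X → ℝ) {T : ℕ} (ω : Fin T → X) (x : X) :
    seqProb k (T + 1) (Fin.snoc (α := fun _ => X) ω x) = seqProb k T ω * k T ω x := by
  rw [seqProb, Fin.prod_univ_castSucc, seqProb]
  congr 1
  · refine Finset.prod_congr rfl fun t _ => ?_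
    rw [Fin.snoc_castSucc]
    exact congrArg (fun u => k t u (ω t)) (snoc_comp_castLE t.2.le ω x)
  · rw [Fin.snoc_last]
    exact congrArg (fun u => k T u x) (snoc_comp_castLE le_rfl ω x)

theorem sum_adapted_snoc (d : (t : ℕ) → (Fin t → X) → X → ℝ) {T : ℕ} (ω : Fin T → X) (x : X) :
    ∑ t : Fin (T + 1), d t (fun j : Fin t =>
        (Fin.snoc (α := fun _ => X) ω x : Fin (T + 1) → X) (Fin.castLE t.2.le j))
        ((Fin.snoc (α := fun _ => X) ω x : Fin (T + 1) → X) t) =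
      ∑ t : Fin T, d t (fun j : Fin t => ω (Fin.castLE t.2.le j)) (ω t) + d T ω x := by
  rw [Fin.sum_univ_castSucc]
  congr 1
  · refine Finset.sum_congr rfl fun t _ => ?_
    rw [Fin.snoc_castSucc]
    exact congrArg (fun u => d t u (ω t)) (snoc_comp_castLE t.2.le ω x)
  · rw [Fin.snoc_last]
    exact congrArg (fun u => d T u x) (snoc_comp_castLE le_rfl ω x)

theorem seqProb_nonneg {k : (t : ℕ) → (Fin t → X) → X → ℝ} {T : ℕ}
    (hk : ∀ t < T, ∀ u x, 0 ≤ k t u x) (ω : Fin T → X) : 0 ≤ seqProb k T ω :=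
  Finset.prod_nonneg fun t _ => hk t t.2 _ _

theorem sum_seqProb_eq_one [Fintype X] {k : (t : ℕ) → (Fin t → X) → X → ℝ} {T : ℕ}
    (hk : ∀ t < T, ∀ u, ∑ x, k t u x = 1) : ∑ ω, seqProb k T ω = 1 := by
  induction T with
  | zero => simp [seqProb]
  | succ T ih =>
    rw [sum_pi_fin_succ, ← ih fun t ht => hk t (ht.trans T.lt_succ_self)]
    refine Finset.sum_congr rfl fun ω _ => ?_
    simp_rw [seqProb_snoc, ← Finset.mul_sum, hk T T.lt_succ_self, mul_one]

theorem sum_seqProb_le_one [Fintype X] {k : (t : ℕ) → (Fin t → X) → X → ℝ} {T : ℕ}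
    (h0 : ∀ t < T, ∀ u x, 0 ≤ k t u x) (hk : ∀ t < T, ∀ u, ∑ x, k t u x ≤ 1) :
    ∑ ω, seqProb k T ω ≤ 1 := by
  induction T with
  | zero => simp [seqProb]
  | succ T ih =>
    have h0' : ∀ t < T, ∀ u x, 0 ≤ k t u x := fun t ht => h0 t (ht.trans T.lt_succ_self)
    rw [sum_pi_fin_succ]
    refine le_trans (Finset.sum_le_sum fun ω _ => ?_)
      (ih h0' fun t ht => hk t (ht.trans T.lt_succ_self))
    simp_rw [seqProb_snoc, ← Finset.mul_sum]
    exact mul_le_of_le_one_right (seqProb_nonneg h0' ω) (hk T T.lt_succ_self ω)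

/-- The `ℓ¹`-distance of two sequence laws is at most the expected sum of the `ℓ¹`-distances of
their one-step laws. -/
theorem sum_abs_seqProb_sub_le [Fintype X] {k k' : (t : ℕ) → (Fin t → X) → X → ℝ} {T : ℕ}
    (h0 : ∀ t < T, ∀ u x, 0 ≤ k t u x) (hk : ∀ t < T, ∀ u, ∑ x, k t u x = 1)
    (h0' : ∀ t < T, ∀ u x, 0 ≤ k' t u x) (hk' : ∀ t < T, ∀ u, ∑ x, k' t u x = 1) :
    ∑ ω, |seqProb k' T ω - seqProb k T ω| ≤ ∑ ω, seqProb k T ω *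
      ∑ t : Fin T, ∑ x, |k' t (fun j : Fin t => ω (Fin.castLE t.2.le j)) x -
        k t (fun j : Fin t => ω (Fin.castLE t.2.le j)) x| := by
  induction T with
  | zero => simp [seqProb]
  | succ T ih =>
    have hT := T.lt_succ_self
    specialize ih (fun t ht => h0 t (ht.trans hT)) (fun t ht => hk t (ht.trans hT))
      (fun t ht => h0' t (ht.trans hT)) (fun t ht => hk' t (ht.trans hT))
    rw [sum_pi_fin_succ, sum_pi_fin_succ]
    have hstep : ∀ ω : Fin T → X,
        ∑ x, |seqProb k' (T + 1) (Fin.snoc (α := fun _ => X) ω x) -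
          seqProb k (T + 1) (Fin.snoc (α := fun _ => X) ω x)| ≤
        |seqProb k' T ω - seqProb k T ω| + seqProb k T ω * ∑ x, |k' T ω x - k T ω x| := by
      intro ω
      have hω : 0 ≤ seqProb k T ω := seqProb_nonneg (fun t ht => h0 t (ht.trans hT)) ω
      calc ∑ x, |seqProb k' (T + 1) (Fin.snoc (α := fun _ => X) ω x) -
            seqProb k (T + 1) (Fin.snoc (α := fun _ => X) ω x)|
          ≤ ∑ x, (|seqProb k' T ω - seqProb k T ω| * k' T ω x +
              seqProb k T ω * |k' T ω x - k T ω x|) := by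
            refine Finset.sum_le_sum fun x _ => ?_
            rw [seqProb_snoc, seqProb_snoc]
            calc _ = |(seqProb k' T ω - seqProb k T ω) * k' T ω x +
                  seqProb k T ω * (k' T ω x - k T ω x)| := by congr 1; ring
              _ ≤ _ := abs_add_le _ _
              _ = _ := by rw [abs_mul, abs_mul, abs_of_nonneg hω, abs_of_nonneg (h0' T hT ω x)]
        _ = _ := by
            rw [Finset.sum_add_distrib, ← Finset.mul_sum, ← Finset.mul_sum, hk' T hT, mul_one]
    refine (Finset.sum_le_sum fun ω _ => hstep ω).trans ?_
    rw [Finset.sum_add_distrib]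
    refine (add_le_add_left ih _).trans (le_of_eq ?_)
    rw [← Finset.sum_add_distrib]
    refine Finset.sum_congr rfl fun ω _ => ?_
    simp_rw [seqProb_snoc, sum_adapted_snoc (fun t u _ => ∑ y, |k' t u y - k t u y|)]
    rw [← Finset.sum_mul, ← Finset.mul_sum, hk T hT, mul_one, mul_add]

end Sequences

/-- Hoeffding's lemma on a finite type. -/
theorem sum_mul_exp_le_of_mem_Icc {X : Type*} [Fintype X] {p f : X → ℝ} {a b : ℝ}
    (hp : ∀ x, 0 ≤ p x) (hp1 : ∑ x, p x = 1) (hf : ∀ x, f x ∈ Set.Icc a b) (c : ℝ) :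
    ∑ x, p x * Real.exp (c * (f x - ∑ y, p y * f y)) ≤ Real.exp (c ^ 2 * (b - a) ^ 2 / 8) := by
  let _ : MeasurableSpace X := ⊤
  have : MeasurableSingletonClass X := ⟨fun _ => trivial⟩
  let q : PMF X := PMF.ofFintype (fun x => ENNReal.ofReal (p x)) (by
    rw [← ENNReal.ofReal_sum_of_nonneg fun x _ => hp x, hp1, ENNReal.ofReal_one])
  have hq : ∀ x, (q x).toReal = p x := fun x => by
    simp [q, ENNReal.toReal_ofReal (hp x)]
  have hmean : ∫ x, f x ∂q.toMeasure = ∑ y, p y * f y := by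
    rw [PMF.integral_eq_sum]
    simp [hq]
  have h := (ProbabilityTheory.hasSubgaussianMGF_of_mem_Icc (μ := q.toMeasure) (X := f) (a := a)
    (b := b) (measurable_from_top.aemeasurable) (Filter.Eventually.of_forall hf)).mgf_le c
  rw [ProbabilityTheory.mgf, PMF.integral_eq_sum, hmean] at h
  simp only [hq, smul_eq_mul] at h
  refine h.trans (Real.exp_le_exp.2 (le_of_eq ?_))
  push_cast
  rw [div_pow, Real.norm_eq_abs, sq_abs]
  ring

section Episodes

variable {S A : Type*} [Fintype S] [Fintype A] {H : ℕ}

/-- The law of the next state, given the steps made so far in an episode. -/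
def nextState (ρ : stdSimplex ℝ S) (P : Transition S A) :
    (h : ℕ) → (Fin h → S × A) → stdSimplex ℝ S
  | 0, _ => ρ
  | k + 1, u => P (u (Fin.last k)).1 (u (Fin.last k)).2

/-- The one-step law of an episode. -/
noncomputable def stepProb (ρ : stdSimplex ℝ S) (P : Transition S A) (π : Policy S A H)
    (h : ℕ) (u : Fin h → S × A) (x : S × A) : ℝ :=
  if hh : h < H then (nextState ρ P h u).1 x.1 * (π ⟨h, hh⟩ x.1).1 x.2 else 0

/-- A function of the last transition, as a function of the past and the present step. -/
def lastTransition (F : S × A → S → ℝ) : (h : ℕ) → (Fin h → S × A) → S × A → ℝ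
  | 0, _, _ => 0
  | k + 1, u, x => F (u (Fin.last k)) x.1

/-- The sum of a function over the transitions of an episode. -/
noncomputable def transitionSum (F : S × A → S → ℝ) (τ : Episode S A H) : ℝ :=
  ∑ h : Fin H, if hh : (h : ℕ) + 1 < H then F (τ h) (τ ⟨h + 1, hh⟩).1 else 0

theorem sum_lastTransition (F : S × A → S → ℝ) (τ : Episode S A H) :
    ∑ h : Fin H, lastTransition F h (fun j : Fin h => τ (Fin.castLE h.2.le j)) (τ h) =
      transitionSum F τ := by
  cases H with
  | zero => simp [transitionSum]
  | succ m =>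
    rw [transitionSum, Fin.sum_univ_succ, Fin.sum_univ_castSucc]
    simp only [Fin.val_last, lt_self_iff_false, dite_false, add_zero]
    have h0 : ∀ (u : Fin ((0 : Fin (m + 1)) : ℕ) → S × A) x,
        lastTransition F ((0 : Fin (m + 1)) : ℕ) u x = 0 := fun _ _ => rfl
    rw [h0, zero_add]
    refine Finset.sum_congr rfl fun k _ => ?_
    have hk : ((Fin.castSucc k : Fin (m + 1)) : ℕ) + 1 < m + 1 := by simp
    rw [dif_pos hk]
    rfl

theorem episodeProb_eq_seqProb (ρ : stdSimplex ℝ S) (P : Transition S A) (π : Policy S A H)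
    (τ : Episode S A H) : episodeProb ρ P π τ = seqProb (stepProb ρ P π) H τ := by
  refine Finset.prod_congr rfl fun h _ => ?_
  rw [stepProb, dif_pos h.2]
  congr 1
  obtain ⟨h, hh⟩ := h
  cases h with
  | zero => simp [arrivalProb, nextState]
  | succ k => rfl

theorem stepProb_nonneg (ρ : stdSimplex ℝ S) (P : Transition S A) (π : Policy S A H)
    (h : ℕ) (u : Fin h → S × A) (x : S × A) : 0 ≤ stepProb ρ P π h u x := by
  rw [stepProb]
  split_ifs
  · exact mul_nonneg ((nextState ρ P h u).2.1 _) ((π _ _).2.1 _)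
  · exact le_rfl

theorem sum_stepProb_mul (ρ : stdSimplex ℝ S) (P : Transition S A) (π : Policy S A H)
    {h : ℕ} (hh : h < H) (u : Fin h → S × A) (f : S → ℝ) :
    ∑ x, stepProb ρ P π h u x * f x.1 = ∑ s, (nextState ρ P h u).1 s * f s := by
  rw [Fintype.sum_prod_type]
  refine Finset.sum_congr rfl fun s _ => ?_
  simp only [stepProb, dif_pos hh]
  rw [← Finset.sum_mul, ← Finset.mul_sum, (π ⟨h, hh⟩ s).2.2, mul_one]

theorem sum_stepProb (ρ : stdSimplex ℝ S) (P : Transition S A) (π : Policy S A H)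
    {h : ℕ} (hh : h < H) (u : Fin h → S × A) : ∑ x, stepProb ρ P π h u x = 1 := by
  have := sum_stepProb_mul ρ P π hh u fun _ => 1
  simpa [(nextState ρ P h u).2.2] using this

theorem episodeProb_nonneg (ρ : stdSimplex ℝ S) (P : Transition S A) (π : Policy S A H)
    (τ : Episode S A H) : 0 ≤ episodeProb ρ P π τ := by
  rw [episodeProb_eq_seqProb]
  exact seqProb_nonneg (fun h _ => stepProb_nonneg ρ P π h) τ

theorem sum_episodeProb (ρ : stdSimplex ℝ S) (P : Transition S A) (π : Policy S A H) :
    ∑ τ, episodeProb ρ P π τ = 1 := by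
  simp_rw [episodeProb_eq_seqProb]
  exact sum_seqProb_eq_one fun h hh u => sum_stepProb ρ P π hh u

/-- The `ℓ¹`-distance of two transition functions at a state-action pair. -/
noncomputable def transitionDist (P P' : Transition S A) (z : S × A) : ℝ :=
  ∑ s, |(P' z.1 z.2).1 s - (P z.1 z.2).1 s|

theorem sum_abs_episodeProb_sub_le (ρ : stdSimplex ℝ S) (P P' : Transition S A)
    (π : Policy S A H) :
    ∑ τ, |episodeProb ρ P' π τ - episodeProb ρ P π τ| ≤
      ∑ τ, episodeProb ρ P π τ * transitionSum (fun z _ => transitionDist P P' z) τ := by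
  simp_rw [episodeProb_eq_seqProb]
  refine (sum_abs_seqProb_sub_le (fun h _ => stepProb_nonneg ρ P π h)
    (fun h hh u => sum_stepProb ρ P π hh u) (fun h _ => stepProb_nonneg ρ P' π h)
    (fun h hh u => sum_stepProb ρ P' π hh u)).trans (le_of_eq ?_)
  refine Finset.sum_congr rfl fun τ _ => ?_
  rw [← sum_lastTransition]
  congr 1
  refine Finset.sum_congr rfl fun h _ => ?_
  have key : ∀ (h : ℕ) (hh : h < H) (u : Fin h → S × A) (y : S × A),
      ∑ x, |stepProb ρ P' π h u x - stepProb ρ P π h u x| =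
        lastTransition (fun z _ => transitionDist P P' z) h u y := by
    intro h hh u y
    have h1 : ∑ x, |stepProb ρ P' π h u x - stepProb ρ P π h u x| =
        ∑ s, |(nextState ρ P' h u).1 s - (nextState ρ P h u).1 s| := by
      rw [Fintype.sum_prod_type]
      refine Finset.sum_congr rfl fun s _ => ?_
      simp only [stepProb, dif_pos hh, ← sub_mul, abs_mul]
      rw [← Finset.mul_sum]
      simp_rw [abs_of_nonneg ((π ⟨h, hh⟩ s).2.1 _)]
      rw [(π ⟨h, hh⟩ s).2.2, mul_one]
    rw [h1]
    cases h with
    | zero => simp [nextState, lastTransition]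
    | succ k => rfl
  exact key h h.2 _ _

theorem sum_episodeProb_mul_exp_le (ρ : stdSimplex ℝ S) (P : Transition S A) (π : Policy S A H)
    {F : S × A → S → ℝ} (hF : ∀ z, ∑ s, (P z.1 z.2).1 s * Real.exp (F z s) ≤ 1) :
    ∑ τ, episodeProb ρ P π τ * Real.exp (transitionSum F τ) ≤ 1 := by
  have h : ∀ τ : Episode S A H, episodeProb ρ P π τ * Real.exp (transitionSum F τ) =
      seqProb (fun h u x => stepProb ρ P π h u x * Real.exp (lastTransition F h u x)) H τ := by
    intro τ
    rw [episodeProb_eq_seqProb, ← sum_lastTransition, Real.exp_sum, seqProb, seqProb,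
      ← Finset.prod_mul_distrib]
  simp_rw [h]
  refine sum_seqProb_le_one
    (fun h _ u x => mul_nonneg (stepProb_nonneg ρ P π h u x) (Real.exp_nonneg _)) ?_
  intro h hh u
  cases h with
  | zero => simp [lastTransition, sum_stepProb ρ P π hh]
  | succ k =>
    simp only [lastTransition]
    rw [sum_stepProb_mul ρ P π hh u fun s => Real.exp (F (u (Fin.last k)) s)]
    exact hF _

theorem sum_reward_mem_Icc {r : S → A → ℝ} (hr : ∀ s a, r s a ∈ Set.Icc (0 : ℝ) 1)
    (τ : Episode S A H) : ∑ h : Fin H, r (τ h).1 (τ h).2 ∈ Set.Icc (0 : ℝ) H := by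
  refine ⟨Finset.sum_nonneg fun h _ => (hr _ _).1, ?_⟩
  refine (Finset.sum_le_sum fun h _ => (hr (τ h).1 (τ h).2).2).trans ?_
  simp

theorem value_mem_Icc (ρ : stdSimplex ℝ S) {r : S → A → ℝ}
    (hr : ∀ s a, r s a ∈ Set.Icc (0 : ℝ) 1) (P : Transition S A) (π : Policy S A H) :
    value ρ r P π ∈ Set.Icc (0 : ℝ) H := by
  constructor
  · exact Finset.sum_nonneg fun τ _ =>
      mul_nonneg (episodeProb_nonneg ρ P π τ) (sum_reward_mem_Icc hr τ).1
  · calc value ρ r P π ≤ ∑ τ : Episode S A H, episodeProb ρ P π τ * H :=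
          Finset.sum_le_sum fun τ _ => mul_le_mul_of_nonneg_left (sum_reward_mem_Icc hr τ).2
            (episodeProb_nonneg ρ P π τ)
      _ = H := by rw [← Finset.sum_mul, sum_episodeProb, one_mul]

/-- The simulation lemma: values under two transition functions. -/
theorem abs_value_sub_le (ρ : stdSimplex ℝ S) {r : S → A → ℝ}
    (hr : ∀ s a, r s a ∈ Set.Icc (0 : ℝ) 1) (P P' : Transition S A) (π : Policy S A H) :
    |value ρ r P' π - value ρ r P π| ≤
      H * ∑ τ, episodeProb ρ P π τ * transitionSum (fun z _ => transitionDist P P' z) τ := by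
  refine le_trans ?_ (mul_le_mul_of_nonneg_left (sum_abs_episodeProb_sub_le ρ P P' π)
    (Nat.cast_nonneg H))
  rw [value, value, ← Finset.sum_sub_distrib, Finset.mul_sum]
  refine (Finset.abs_sum_le_sum_abs _ _).trans (Finset.sum_le_sum fun τ _ => ?_)
  rw [← sub_mul, abs_mul, mul_comm, abs_of_nonneg (sum_reward_mem_Icc hr τ).1]
  exact mul_le_mul_of_nonneg_right (sum_reward_mem_Icc hr τ).2 (abs_nonneg _)

theorem abs_prod_sub_prod_le {n : ℕ} {a b : Fin n → ℝ} {B D : ℝ}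
    (ha : ∀ i, a i ∈ Set.Icc 0 B) (hb : ∀ i, b i ∈ Set.Icc 0 B) (hB : 0 ≤ B)
    (hD : ∀ i, |a i - b i| ≤ B * D) :
    |∏ i, a i - ∏ i, b i| ≤ n * B ^ n * D := by
  induction n with
  | zero => simp
  | succ n ih =>
    rw [Fin.prod_univ_succ, Fin.prod_univ_succ]
    have h1 := ih (fun i => ha i.succ) (fun i => hb i.succ) fun i => hD i.succ
    have h2 : ∏ i : Fin n, a i.succ ≤ B ^ n := by
      simpa using Finset.prod_le_prod (s := Finset.univ) (fun i _ => (ha (Fin.succ i)).1)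
        fun i _ => (ha (Fin.succ i)).2
    have h3 : 0 ≤ ∏ i : Fin n, a i.succ := Finset.prod_nonneg fun i _ => (ha (Fin.succ i)).1
    calc _ = |(a 0 - b 0) * ∏ i : Fin n, a i.succ +
          b 0 * (∏ i : Fin n, a i.succ - ∏ i : Fin n, b i.succ)| := by congr 1; ring
      _ ≤ |a 0 - b 0| * ∏ i : Fin n, a i.succ +
          b 0 * |∏ i : Fin n, a i.succ - ∏ i : Fin n, b i.succ| := by
          refine (abs_add_le _ _).trans (le_of_eq ?_)
          rw [abs_mul, abs_mul, abs_of_nonneg h3, abs_of_nonneg (hb 0).1]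
      _ ≤ B * D * B ^ n + B * (n * B ^ n * D) :=
          add_le_add
            (mul_le_mul (hD 0) h2 h3 ((abs_nonneg _).trans (hD 0)))
            (mul_le_mul (hb 0).2 h1 (abs_nonneg _) hB)
      _ = _ := by push_cast; ring

theorem nashWelfare_mem_Icc {n : ℕ} (ρ : stdSimplex ℝ S) {r : Fin n → S → A → ℝ}
    (hr : ∀ i s a, r i s a ∈ Set.Icc (0 : ℝ) 1) (P : Transition S A) (π : Policy S A H) :
    nashWelfare ρ r P π ∈ Set.Icc (0 : ℝ) ((H : ℝ) ^ n) := by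
  refine ⟨Finset.prod_nonneg fun i _ => (value_mem_Icc ρ (hr i) P π).1, ?_⟩
  simpa [nashWelfare] using Finset.prod_le_prod (s := Finset.univ)
    (fun i _ => (value_mem_Icc ρ (hr i) P π).1) fun i _ => (value_mem_Icc ρ (hr i) P π).2

theorem nashWelfare_sub_le {n : ℕ} (ρ : stdSimplex ℝ S) {r : Fin n → S → A → ℝ}
    (hr : ∀ i s a, r i s a ∈ Set.Icc (0 : ℝ) 1) (P P' : Transition S A) (π : Policy S A H) :
    nashWelfare ρ r P' π - nashWelfare ρ r P π ≤ n * (H : ℝ) ^ n *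
      ∑ τ, episodeProb ρ P π τ * transitionSum (fun z _ => transitionDist P P' z) τ :=
  (le_abs_self _).trans <| abs_prod_sub_prod_le (fun i => value_mem_Icc ρ (hr i) P' π)
    (fun i => value_mem_Icc ρ (hr i) P π) (Nat.cast_nonneg H)
    fun i => abs_value_sub_le ρ (hr i) P P' π

end Episodes

section Optimism

variable {S A : Type*} [Fintype S] [Fintype A] [DecidableEq S] [DecidableEq A] {H n : ℕ}

theorem nashWelfare_le_of_mem_confidenceSet {ρ : stdSimplex ℝ S} {r : Fin n → S → A → ℝ}
    (hr : ∀ i s a, r i s a ∈ Set.Icc (0 : ℝ) 1) {δ : ℝ} {alg : Planner S A H}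
    (halg : IsUCRLNash ρ r δ alg) {t : ℕ} {hist : Fin t → Episode S A H} {P : Transition S A}
    (hP : P ∈ confidenceSet δ hist) (π : Policy S A H) :
    nashWelfare ρ r P π ≤ nashWelfare ρ r (alg t hist).1 (alg t hist).2 := by
  obtain ⟨-, h1, h2⟩ := halg t hist
  have hbdd : BddAbove (Set.range fun π : Policy S A H => nashWelfare ρ r P π) :=
    ⟨(H : ℝ) ^ n, by rintro _ ⟨π, rfl⟩; exact (nashWelfare_mem_Icc ρ hr P π).2⟩
  have : Nonempty (Policy S A H) := ⟨π⟩
  exact (le_ciSup hbdd π).trans ((h1 hP).trans (ciSup_le fun π' => h2 (Set.mem_univ π')))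

end Optimism

section Runs

variable {S A : Type*} [Fintype S] [Fintype A] {H T : ℕ}

theorem runProb_eq_seqProb (ρ : stdSimplex ℝ S) (P : Transition S A) (alg : Planner S A H)
    (ω : Fin T → Episode S A H) :
    runProb ρ P alg ω = seqProb (fun t u τ => episodeProb ρ P (alg t u).2 τ) T ω := rfl

theorem runProb_nonneg (ρ : stdSimplex ℝ S) (P : Transition S A) (alg : Planner S A H)
    (ω : Fin T → Episode S A H) : 0 ≤ runProb ρ P alg ω :=
  Finset.prod_nonneg fun _ _ => episodeProb_nonneg ρ P _ _

theorem sum_runProb (ρ : stdSimplex ℝ S) (P : Transition S A) (alg : Planner S A H) :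
    ∑ ω : Fin T → Episode S A H, runProb ρ P alg ω = 1 := by
  simp_rw [runProb_eq_seqProb]
  exact sum_seqProb_eq_one (k := fun t u τ => episodeProb ρ P (alg t u).2 τ)
    fun t _ u => sum_episodeProb ρ P (alg t u).2

theorem probRun_mono (ρ : stdSimplex ℝ S) (P : Transition S A) (alg : Planner S A H)
    {E E' : Set (Fin T → Episode S A H)} (h : E ⊆ E') :
    probRun ρ P alg T E ≤ probRun ρ P alg T E' := by
  refine Finset.sum_le_sum fun ω _ => ?_
  by_cases hω : ω ∈ E
  · rw [if_pos hω, if_pos (h hω)]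
  · rw [if_neg hω]
    split_ifs
    · exact runProb_nonneg ρ P alg ω
    · exact le_rfl

open Classical in
theorem probRun_biUnion_le (ρ : stdSimplex ℝ S) (P : Transition S A) (alg : Planner S A H)
    {ι : Type*} (s : Finset ι) (E : ι → Set (Fin T → Episode S A H)) :
    probRun ρ P alg T (⋃ i ∈ s, E i) ≤ ∑ i ∈ s, probRun ρ P alg T (E i) := by
  simp only [probRun]
  rw [Finset.sum_comm]
  refine Finset.sum_le_sum fun ω _ => ?_
  have h0 : ∀ i ∈ s, 0 ≤ if ω ∈ E i then runProb ρ P alg ω else 0 := fun i _ => by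
    split_ifs
    · exact runProb_nonneg ρ P alg ω
    · exact le_rfl
  by_cases hω : ω ∈ ⋃ i ∈ s, E i
  · rw [if_pos hω]
    simp only [Set.mem_iUnion, exists_prop] at hω
    obtain ⟨i, hi, hωi⟩ := hω
    refine le_trans (le_of_eq ?_) (Finset.single_le_sum h0 hi)
    rw [if_pos hωi]
  · rw [if_neg hω]
    exact Finset.sum_nonneg h0

theorem probRun_union_le (ρ : stdSimplex ℝ S) (P : Transition S A) (alg : Planner S A H)
    (E E' : Set (Fin T → Episode S A H)) :
    probRun ρ P alg T (E ∪ E') ≤ probRun ρ P alg T E + probRun ρ P alg T E' := by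
  have h := probRun_biUnion_le ρ P alg Finset.univ fun b : Bool => if b then E else E'
  rw [Fintype.sum_bool] at h
  refine (probRun_mono ρ P alg ?_).trans h
  rintro ω (hω | hω)
  · simp [hω]
  · simp [hω]

theorem probRun_add_compl (ρ : stdSimplex ℝ S) (P : Transition S A) (alg : Planner S A H)
    (E : Set (Fin T → Episode S A H)) :
    probRun ρ P alg T E + probRun ρ P alg T Eᶜ = 1 := by
  rw [← sum_runProb (T := T) ρ P alg, probRun, probRun, ← Finset.sum_add_distrib]
  refine Finset.sum_congr rfl fun ω _ => ?_
  by_cases hω : ω ∈ E <;> simp [hω]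

/-- Markov's inequality for an exponential supermartingale along the episodes of a run. -/
theorem probRun_le_exp_neg (ρ : stdSimplex ℝ S) (P : Transition S A) (alg : Planner S A H)
    {d : (t : ℕ) → (Fin t → Episode S A H) → Episode S A H → ℝ}
    (hd : ∀ t u, ∑ τ, episodeProb ρ P (alg t u).2 τ * Real.exp (d t u τ) ≤ 1) (c : ℝ) :
    probRun ρ P alg T
      {ω | c ≤ ∑ t : Fin T, d t (fun j : Fin t => ω (Fin.castLE t.2.le j)) (ω t)} ≤
      Real.exp (-c) := by
  have h1 : ∑ ω : Fin T → Episode S A H, runProb ρ P alg ω *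
      Real.exp (∑ t : Fin T, d t (fun j : Fin t => ω (Fin.castLE t.2.le j)) (ω t)) ≤ 1 := by
    refine le_trans (le_of_eq ?_) (sum_seqProb_le_one (T := T)
      (k := fun t u τ => episodeProb ρ P (alg t u).2 τ * Real.exp (d t u τ))
      (fun t _ u τ => mul_nonneg (episodeProb_nonneg ρ P _ τ) (Real.exp_nonneg _))
      fun t _ u => hd t u)
    refine Finset.sum_congr rfl fun ω _ => ?_
    rw [runProb_eq_seqProb, Real.exp_sum, seqProb, seqProb, ← Finset.prod_mul_distrib]
  calc _ ≤ ∑ ω : Fin T → Episode S A H, Real.exp (-c) * (runProb ρ P alg ω *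
        Real.exp (∑ t : Fin T, d t (fun j : Fin t => ω (Fin.castLE t.2.le j)) (ω t))) := by
        refine Finset.sum_le_sum fun ω _ => ?_
        have h0 := runProb_nonneg ρ P alg ω
        split_ifs with hω
        · rw [mul_left_comm, ← Real.exp_add]
          refine le_mul_of_one_le_right h0 (Real.one_le_exp ?_)
          have : c ≤ _ := hω
          linarith
        · positivity
    _ ≤ Real.exp (-c) := by
        rw [← Finset.mul_sum]
        exact mul_le_of_le_one_right (Real.exp_nonneg _) h1

/-- The Azuma-Hoeffding inequality for conditional means along the episodes of a run. -/
theorem probRun_azuma (ρ : stdSimplex ℝ S) (P : Transition S A) (alg : Planner S A H)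
    {f : (t : ℕ) → (Fin t → Episode S A H) → Episode S A H → ℝ} {B : ℝ} (hB : 0 < B)
    (hT : 0 < T) (hf : ∀ t u τ, f t u τ ∈ Set.Icc 0 B) {x : ℝ} (hx : 0 < x) :
    probRun ρ P alg T
      {ω | x ≤ ∑ t : Fin T, ((∑ τ, episodeProb ρ P (playedPolicy alg ω t) τ *
        f t (fun j : Fin t => ω (Fin.castLE t.2.le j)) τ) -
        f t (fun j : Fin t => ω (Fin.castLE t.2.le j)) (ω t))} ≤
      Real.exp (-(2 * x ^ 2 / (T * B ^ 2))) := by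
  have hT' : (0 : ℝ) < T := by exact_mod_cast hT
  set c : ℝ := 4 * x / (T * B ^ 2) with hc
  have hc0 : 0 < c := by positivity
  refine le_trans (probRun_mono ρ P alg ?_) (probRun_le_exp_neg ρ P alg
    (d := fun t u τ => c * (-f t u τ - ∑ τ', episodeProb ρ P (alg t u).2 τ' * -f t u τ') -
      c ^ 2 * B ^ 2 / 8) ?_ _)
  · intro ω hω
    rw [Set.mem_ofPred_eq] at hω ⊢
    rw [Finset.sum_sub_distrib, ← Finset.mul_sum]
    have h2 : ∑ t : Fin T, (-f t (fun j : Fin t => ω (Fin.castLE t.2.le j)) (ω t) -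
        ∑ τ', episodeProb ρ P (alg t (fun j : Fin t => ω (Fin.castLE t.2.le j))).2 τ' *
          -f t (fun j : Fin t => ω (Fin.castLE t.2.le j)) τ') =
        ∑ t : Fin T, ((∑ τ, episodeProb ρ P (playedPolicy alg ω t) τ *
        f t (fun j : Fin t => ω (Fin.castLE t.2.le j)) τ) -
        f t (fun j : Fin t => ω (Fin.castLE t.2.le j)) (ω t)) := by
      refine Finset.sum_congr rfl fun t _ => ?_
      simp only [mul_neg, Finset.sum_neg_distrib, playedPolicy]
      ring
    rw [h2]
    refine le_trans (le_of_eq ?_) (sub_le_sub_right (mul_le_mul_of_nonneg_left hω hc0.le) _)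
    simp only [Finset.sum_const, Finset.card_univ, Fintype.card_fin, nsmul_eq_mul]
    rw [hc]
    field_simp
    ring
  · intro t u
    simp_rw [Real.exp_sub _ (c ^ 2 * B ^ 2 / 8), mul_div_assoc', ← Finset.sum_div]
    rw [div_le_one (Real.exp_pos _)]
    refine (sum_mul_exp_le_of_mem_Icc (fun τ => episodeProb_nonneg ρ P (alg t u).2 τ)
      (sum_episodeProb ρ P _) (f := fun τ => -f t u τ) (a := -B) (b := 0)
      (fun τ => ⟨neg_le_neg (hf t u τ).2, neg_nonpos.2 (hf t u τ).1⟩) c).trans (le_of_eq ?_)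
    congr 1
    ring

end Runs

section Counts

variable {S A : Type*} [Fintype S] [Fintype A] [DecidableEq S] [DecidableEq A] {H T : ℕ}

theorem sum_transitionSum_ite {t : ℕ} (hist : Fin t → Episode S A H) (s : S) (a : A)
    (g : S → ℝ) :
    ∑ k, transitionSum (fun z s' => if z = (s, a) then g s' else 0) (hist k) =
      ∑ s', (transitionCount hist s a s' : ℝ) * g s' := by
  simp only [transitionCount, Nat.cast_sum, Finset.sum_mul]
  rw [Finset.sum_comm]
  refine Finset.sum_congr rfl fun k _ => ?_
  rw [Finset.sum_comm]
  refine Finset.sum_congr rfl fun h _ => ?_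
  by_cases h1 : (h : ℕ) + 1 < H <;> by_cases h2 : hist k h = (s, a) <;> simp [h1, h2]

theorem sum_transitionCount {t : ℕ} (hist : Fin t → Episode S A H) (s : S) (a : A) :
    ∑ s', transitionCount hist s a s' = visitCount hist s a := by
  simp only [transitionCount, visitCount]
  rw [Finset.sum_comm]
  refine Finset.sum_congr rfl fun k _ => ?_
  rw [Finset.sum_comm]
  refine Finset.sum_congr rfl fun h _ => ?_
  by_cases h1 : (h : ℕ) + 1 < H <;> by_cases h2 : hist k h = (s, a) <;> simp [h1, h2]

theorem visitCount_le {t : ℕ} (hist : Fin t → Episode S A H) (s : S) (a : A) :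
    visitCount hist s a ≤ t * H := by
  refine (Finset.sum_le_sum fun k _ => Finset.sum_le_sum fun h _ =>
    (show _ ≤ 1 by split_ifs <;> simp)).trans ?_
  simp

theorem sum_ite_lt_eq_sum_castLE {t : ℕ} (ht : t ≤ T) (f : Fin T → ℝ) :
    ∑ k : Fin T, (if (k : ℕ) < t then f k else 0) = ∑ k : Fin t, f (Fin.castLE ht k) := by
  obtain ⟨m, rfl⟩ := Nat.exists_eq_add_of_le ht
  rw [Fin.sum_univ_add]
  have h2 : ∑ i : Fin m, (if ((Fin.natAdd t i : Fin (t + m)) : ℕ) < t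
      then f (Fin.natAdd t i) else 0) = 0 := Finset.sum_eq_zero fun i _ => by simp
  rw [h2, add_zero]
  refine Finset.sum_congr rfl fun i _ => ?_
  rw [if_pos (by simp)]
  rfl

/-- The exponential deviation inequality for the transitions from a state-action pair that were
observed in the first `t` episodes. -/
theorem probRun_transition_deviation (ρ : stdSimplex ℝ S) (P : Transition S A)
    (alg : Planner S A H) {t : ℕ} (ht : t ≤ T) (s : S) (a : A) {σ : S → ℝ}
    (hσ : ∀ s', σ s' ∈ Set.Icc (-1 : ℝ) 1) (c x : ℝ) :
    probRun ρ P alg T {ω | x ≤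
      c * (∑ s', σ s' * ((transitionCount (fun k : Fin t => ω (Fin.castLE ht k)) s a s' : ℝ) -
        visitCount (fun k : Fin t => ω (Fin.castLE ht k)) s a * (P s a).1 s')) -
      c ^ 2 / 2 * visitCount (fun k : Fin t => ω (Fin.castLE ht k)) s a} ≤ Real.exp (-x) := by
  set m : ℝ := ∑ s', (P s a).1 s' * σ s' with hm
  let g : S → ℝ := fun s' => c * (σ s' - m) - c ^ 2 / 2
  let F : S × A → S → ℝ := fun z s' => if z = (s, a) then g s' else 0
  refine le_trans (probRun_mono ρ P alg ?_) (probRun_le_exp_neg ρ P alg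
    (d := fun k _ τ => if k < t then transitionSum F τ else 0) ?_ x)
  · intro ω hω
    rw [Set.mem_ofPred_eq] at hω ⊢
    rw [sum_ite_lt_eq_sum_castLE ht fun k => transitionSum F (ω k)]
    refine hω.trans (le_of_eq ?_)
    rw [sum_transitionSum_ite (fun k : Fin t => ω (Fin.castLE ht k)) s a g]
    set N := fun s' => (transitionCount (fun k : Fin t => ω (Fin.castLE ht k)) s a s' : ℝ)
    have hN : (visitCount (fun k : Fin t => ω (Fin.castLE ht k)) s a : ℝ) = ∑ s', N s' := by
      rw [← sum_transitionCount]; push_cast; rfl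
    have h1 : ∑ s', N s' * g s' = c * ∑ s', N s' * σ s' - c * m * ∑ s', N s' -
        c ^ 2 / 2 * ∑ s', N s' := by
      simp only [g, Finset.mul_sum, ← Finset.sum_sub_distrib]
      exact Finset.sum_congr rfl fun s' _ => by ring
    rw [hN, h1, hm]
    have h2 : ∑ s', σ s' * (N s' - (∑ s'', N s'') * (P s a).1 s') =
        ∑ s', N s' * σ s' - (∑ s', (P s a).1 s' * σ s') * ∑ s', N s' := by
      rw [Finset.sum_mul, ← Finset.sum_sub_distrib]
      exact Finset.sum_congr rfl fun s' _ => by ring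
    rw [h2]
    ring
  · intro k u
    by_cases hk : k < t
    · simp only [hk, if_true]
      refine sum_episodeProb_mul_exp_le ρ P _ fun z => ?_
      by_cases hz : z = (s, a)
      · subst hz
        simp only [F, g, if_true]
        simp_rw [Real.exp_sub _ (c ^ 2 / 2), mul_div_assoc', ← Finset.sum_div]
        rw [div_le_one (Real.exp_pos _)]
        refine (sum_mul_exp_le_of_mem_Icc (P s a).2.1 (P s a).2.2 hσ c).trans (le_of_eq ?_)
        congr 1
        ring
      · simp [F, hz, (P z.1 z.2).2.2]
    · simp [hk, sum_episodeProb]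

end Counts

section ConfidenceSets

variable {S A : Type*} [Fintype S] [Fintype A] [DecidableEq S] [DecidableEq A] {H T : ℕ}

/-- The logarithmic factor of the confidence radius after `t` episodes. -/
noncomputable def logFactor (S A : Type*) [Fintype S] [Fintype A] (δ : ℝ) (t : ℕ) : ℝ :=
  Real.log ((Fintype.card S : ℝ) * (Fintype.card A : ℝ) * ((t : ℝ) + 1) / δ)

/-- The confidence radius at a state-action pair. -/
noncomputable def confRadius (δ : ℝ) {t : ℕ} (hist : Fin t → Episode S A H) (z : S × A) : ℝ :=
  Real.sqrt (4 * (Fintype.card S : ℝ) * logFactor S A δ t / max 1 (visitCount hist z.1 z.2 : ℝ))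

theorem mem_confidenceSet_iff {δ : ℝ} {t : ℕ} {hist : Fin t → Episode S A H}
    {P : Transition S A} : P ∈ confidenceSet δ hist ↔
      ∀ s a, ∑ s', |(P s a).1 s' - empirical hist s a s'| ≤ confRadius δ hist (s, a) := Iff.rfl

theorem sum_abs_stdSimplex_sub_le {p q : S → ℝ} (hp : p ∈ stdSimplex ℝ S)
    (hq : q ∈ stdSimplex ℝ S) : ∑ s, |p s - q s| ≤ 2 := by
  calc ∑ s, |p s - q s| ≤ ∑ s, (p s + q s) := Finset.sum_le_sum fun s _ =>
        abs_le.2 ⟨by linarith [hp.1 s], by linarith [hq.1 s]⟩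
    _ = 2 := by rw [Finset.sum_add_distrib, hp.2, hq.2]; norm_num

theorem transitionDist_le_two (P P' : Transition S A) (z : S × A) :
    transitionDist P P' z ≤ 2 :=
  sum_abs_stdSimplex_sub_le (P' z.1 z.2).2 (P z.1 z.2).2

theorem transitionDist_le_of_mem {δ : ℝ} {t : ℕ} {hist : Fin t → Episode S A H}
    {P P' : Transition S A} (hP : P ∈ confidenceSet δ hist) (hP' : P' ∈ confidenceSet δ hist)
    (z : S × A) : transitionDist P P' z ≤ 2 * confRadius δ hist z := by
  have h1 := mem_confidenceSet_iff.1 hP z.1 z.2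
  have h2 := mem_confidenceSet_iff.1 hP' z.1 z.2
  calc transitionDist P P' z
      ≤ ∑ s', (|(P' z.1 z.2).1 s' - empirical hist z.1 z.2 s'| +
          |(P z.1 z.2).1 s' - empirical hist z.1 z.2 s'|) :=
        Finset.sum_le_sum fun s' _ => by
          rw [abs_sub_comm ((P z.1 z.2).1 s')]
          exact abs_sub_le _ _ _
    _ ≤ 2 * confRadius δ hist z := by rw [Finset.sum_add_distrib]; linarith

theorem exists_deviation_of_notMem_confidenceSet {δ : ℝ} {t : ℕ}
    {hist : Fin t → Episode S A H} {P : Transition S A}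
    (hℓ : 1 ≤ Fintype.card S * logFactor S A δ t) (hP : P ∉ confidenceSet δ hist) :
    ∃ (s : S) (a : A) (σ : S → Bool), ∃ m ∈ Finset.Icc 1 (t * H),
      2 * Fintype.card S * logFactor S A δ t ≤
        Real.sqrt (4 * Fintype.card S * logFactor S A δ t / m) *
          (∑ s', (if σ s' then (1 : ℝ) else -1) * ((transitionCount hist s a s' : ℝ) -
            visitCount hist s a * (P s a).1 s')) -
        Real.sqrt (4 * Fintype.card S * logFactor S A δ t / m) ^ 2 / 2 *
          visitCount hist s a := by
  rw [mem_confidenceSet_iff] at hP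
  push Not at hP
  obtain ⟨s, a, h⟩ := hP
  set ℓ := logFactor S A δ t with hℓdef
  have hempty : Nonempty S := ⟨s⟩
  have hm1 : 1 ≤ visitCount hist s a := by
    by_contra h0
    have h0 : visitCount hist s a = 0 := by omega
    have h2 : ∑ s', |(P s a).1 s' - empirical hist s a s'| ≤ 2 := by
      refine sum_abs_stdSimplex_sub_le (P s a).2 ⟨fun s' => ?_, ?_⟩
      · simp only [empirical, h0, if_true]; positivity
      · simp [empirical, h0]
    have h3 : (2 : ℝ) ≤ confRadius δ hist (s, a) := by
      refine Real.le_sqrt_of_sq_le ?_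
      simp only [h0, Nat.cast_zero]
      norm_num
      linarith
    linarith
  set m := visitCount hist s a with hm
  have hm0 : (0 : ℝ) < m := by exact_mod_cast hm1
  refine ⟨s, a, fun s' => decide ((P s a).1 s' ≤ empirical hist s a s'), m,
    Finset.mem_Icc.2 ⟨hm1, visitCount_le hist s a⟩, ?_⟩
  set c := Real.sqrt (4 * Fintype.card S * ℓ / m) with hc
  have hc2 : c ^ 2 = 4 * Fintype.card S * ℓ / m := Real.sq_sqrt (by
    have : 0 ≤ 4 * (Fintype.card S * ℓ) := by linarith
    rw [← mul_assoc] at this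
    positivity)
  have hsum : ∑ s', (if decide ((P s a).1 s' ≤ empirical hist s a s') then (1 : ℝ) else -1) *
      ((transitionCount hist s a s' : ℝ) - m * (P s a).1 s') =
      m * ∑ s', |(P s a).1 s' - empirical hist s a s'| := by
    rw [Finset.mul_sum]
    refine Finset.sum_congr rfl fun s' _ => ?_
    have he : (transitionCount hist s a s' : ℝ) = m * empirical hist s a s' := by
      rw [empirical, if_neg (by omega), ← hm]
      field_simp
    rw [he]
    by_cases hs : (P s a).1 s' ≤ empirical hist s a s'
    · rw [abs_of_nonpos (by linarith)]
      simp only [hs, decide_true, if_true]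
      ring
    · rw [abs_of_nonneg (by linarith)]
      simp only [hs, decide_false, Bool.false_eq_true, if_false]
      ring
  rw [hsum]
  have hrad : confRadius δ hist (s, a) = c := by
    rw [confRadius, hc, max_eq_right (by exact_mod_cast hm1)]
  rw [hrad] at h
  have h4 : c * (m * c) ≤ c * (m * ∑ s', |(P s a).1 s' - empirical hist s a s'|) := by
    have : 0 ≤ c := Real.sqrt_nonneg _
    gcongr
  have h5 : c * (m * c) = 4 * Fintype.card S * ℓ := by
    rw [show c * (m * c) = c ^ 2 * m by ring, hc2]
    field_simp
  have h6 : c ^ 2 / 2 * m = 2 * Fintype.card S * ℓ := by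
    rw [hc2]
    field_simp
    ring
  rw [h6]
  linarith

theorem probRun_notMem_confidenceSet_le (ρ : stdSimplex ℝ S) (P : Transition S A)
    (alg : Planner S A H) {δ : ℝ} {t : ℕ} (ht : t ≤ T)
    (hℓ : 1 ≤ Fintype.card S * logFactor S A δ t) :
    probRun ρ P alg T {ω | P ∉ confidenceSet δ fun k : Fin t => ω (Fin.castLE ht k)} ≤
      Fintype.card S * Fintype.card A * 2 ^ Fintype.card S * (t * H) *
        Real.exp (-(2 * Fintype.card S * logFactor S A δ t)) := by
  set ℓ := logFactor S A δ t
  refine (probRun_mono ρ P alg ?_).trans ((probRun_biUnion_le ρ P alg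
    ((Finset.univ : Finset (S × A × (S → Bool))) ×ˢ Finset.Icc 1 (t * H))
    fun i => {ω | 2 * Fintype.card S * ℓ ≤ Real.sqrt (4 * Fintype.card S * ℓ / i.2) *
      (∑ s', (if i.1.2.2 s' then (1 : ℝ) else -1) *
        ((transitionCount (fun k : Fin t => ω (Fin.castLE ht k)) i.1.1 i.1.2.1 s' : ℝ) -
        visitCount (fun k : Fin t => ω (Fin.castLE ht k)) i.1.1 i.1.2.1 *
          (P i.1.1 i.1.2.1).1 s')) -
      Real.sqrt (4 * Fintype.card S * ℓ / i.2) ^ 2 / 2 *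
        visitCount (fun k : Fin t => ω (Fin.castLE ht k)) i.1.1 i.1.2.1}).trans ?_)
  · intro ω hω
    obtain ⟨s, a, σ, m, hm, h⟩ := exists_deviation_of_notMem_confidenceSet hℓ hω
    simp only [Set.mem_iUnion]
    exact ⟨((s, a, σ), m), Finset.mem_product.2 ⟨Finset.mem_univ _, hm⟩, h⟩
  · refine (Finset.sum_le_sum fun i _ => probRun_transition_deviation ρ P alg ht i.1.1 i.1.2.1
      (fun s' => ?_) _ _).trans (le_of_eq ?_)
    · split_ifs <;> norm_num
    · rw [Finset.sum_const, Finset.card_product, nsmul_eq_mul]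
      simp
      left
      ring

theorem one_le_card_mul_logFactor {δ : ℝ} (h0 : 0 < δ) (h1 : δ < 1)
    (hS : 2 ≤ Fintype.card S) (hA : 1 ≤ Fintype.card A) (t : ℕ) :
    1 ≤ Fintype.card S * logFactor S A δ t := by
  have hS' : (2 : ℝ) ≤ Fintype.card S := by exact_mod_cast hS
  have hA' : (1 : ℝ) ≤ Fintype.card A := by exact_mod_cast hA
  have h2 : (2 : ℝ) ≤ (Fintype.card S : ℝ) * (Fintype.card A : ℝ) * ((t : ℝ) + 1) / δ := by
    rw [le_div_iff₀ h0]
    have ht : (1 : ℝ) ≤ (t : ℝ) + 1 := by linarith [Nat.cast_nonneg (α := ℝ) t]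
    have h3 : (2 : ℝ) * 1 * 1 ≤ (Fintype.card S : ℝ) * (Fintype.card A : ℝ) * ((t : ℝ) + 1) := by
      gcongr
    linarith
  have h3 : Real.log 2 ≤ logFactor S A δ t := Real.log_le_log two_pos h2
  have h4 := Real.log_two_gt_d9
  nlinarith

theorem confidence_failure_bound {δ : ℝ} (h0 : 0 < δ) (h1 : δ < 1)
    (hS : 2 ≤ Fintype.card S) (hA : 1 ≤ Fintype.card A) {t : ℕ} (ht : H ≤ t + 1) :
    (Fintype.card S : ℝ) * Fintype.card A * 2 ^ Fintype.card S * (t * H) *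
        Real.exp (-(2 * Fintype.card S * logFactor S A δ t)) ≤
      δ / 2 * (1 / ((t : ℝ) + 1) ^ 2) := by
  have hS' : (2 : ℝ) ≤ Fintype.card S := by exact_mod_cast hS
  have hA' : (1 : ℝ) ≤ Fintype.card A := by exact_mod_cast hA
  have ht' : (H : ℝ) ≤ (t : ℝ) + 1 := by exact_mod_cast ht
  have ht0 : (0 : ℝ) ≤ t := Nat.cast_nonneg t
  set B : ℝ := (Fintype.card S : ℝ) * Fintype.card A with hB
  have hB2 : 2 ≤ B := by
    have : (2 : ℝ) * 1 ≤ B := mul_le_mul hS' hA' zero_le_one (by linarith)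
    linarith
  set x : ℝ := B * ((t : ℝ) + 1) / δ with hx
  have hxδ : x * δ = B * ((t : ℝ) + 1) := by rw [hx]; field_simp
  have hx2 : 2 * ((t : ℝ) + 1) ≤ x := by
    rw [hx, le_div_iff₀ h0]
    have : 2 * ((t : ℝ) + 1) ≤ B * ((t : ℝ) + 1) := by gcongr
    nlinarith
  have hx0 : 0 < x := by linarith
  have hexp : Real.exp (-(2 * Fintype.card S * logFactor S A δ t)) =
      ((x ^ 2) ^ Fintype.card S)⁻¹ := by
    rw [Real.exp_neg, logFactor, ← hB, ← hx, ← pow_mul, mul_comm, ← Real.rpow_natCast,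
      Real.rpow_def_of_pos hx0]
    push_cast
    ring_nf
  have hpow : (2 : ℝ) ^ Fintype.card S * ((x ^ 2) ^ Fintype.card S)⁻¹ ≤ (2 / x ^ 2) ^ 2 := by
    rw [← div_eq_mul_inv, ← div_pow]
    refine pow_le_pow_of_le_one (by positivity) ?_ hS
    rw [div_le_one (by positivity)]
    nlinarith
  calc B * 2 ^ Fintype.card S * (t * H) * Real.exp (-(2 * Fintype.card S * logFactor S A δ t))
      = B * (t * H) * ((2 : ℝ) ^ Fintype.card S * ((x ^ 2) ^ Fintype.card S)⁻¹) := by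
        rw [hexp]; ring
    _ ≤ B * (((t : ℝ) + 1) * ((t : ℝ) + 1)) * (2 / x ^ 2) ^ 2 := by
        gcongr
        linarith
    _ ≤ δ / 2 * (1 / ((t : ℝ) + 1) ^ 2) := by
        have h8 : (2 * ((t : ℝ) + 1)) ^ 3 ≤ x ^ 3 := by gcongr
        have h9 : B * ((t : ℝ) + 1) * (2 * ((t : ℝ) + 1)) ^ 3 ≤ x * δ * x ^ 3 := by
          rw [hxδ]; gcongr
        rw [div_pow, mul_div_assoc', div_mul_div_comm, div_le_div_iff₀ (by positivity)
          (by positivity)]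
        nlinarith

theorem sum_one_div_sq_le (T : ℕ) :
    ∑ t ∈ Finset.range T, (if 1 ≤ t then 1 / ((t : ℝ) + 1) ^ 2 else 0) ≤ 1 := by
  have key : ∀ T : ℕ, ∑ t ∈ Finset.range (T + 1),
      (if 1 ≤ t then 1 / ((t : ℝ) + 1) ^ 2 else 0) ≤ 1 - 1 / ((T : ℝ) + 1) := by
    intro T
    induction T with
    | zero => simp
    | succ T ih =>
      rw [Finset.sum_range_succ, if_pos (by omega)]
      have h : 1 / (((T + 1 : ℕ) : ℝ) + 1) ^ 2 ≤
          1 / ((T : ℝ) + 1) - 1 / (((T + 1 : ℕ) : ℝ) + 1) := by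
        push_cast
        rw [div_sub_div _ _ (by positivity) (by positivity),
          div_le_div_iff₀ (by positivity) (by positivity)]
        nlinarith [Nat.cast_nonneg (α := ℝ) T]
      linarith
  cases T with
  | zero => simp
  | succ T =>
    refine (key T).trans ?_
    have : 0 ≤ 1 / ((T : ℝ) + 1) := by positivity
    linarith

/-- After a burn-in of `H` episodes the confidence sets contain the true transition function,
except with probability `δ / 2`. -/
theorem probRun_exists_notMem_confidenceSet_le (ρ : stdSimplex ℝ S) (P : Transition S A)
    (alg : Planner S A H) {δ : ℝ} (h0 : 0 < δ) (h1 : δ < 1) (hS : 2 ≤ Fintype.card S)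
    (hA : 1 ≤ Fintype.card A) {t₀ : ℕ} (ht₀ : 1 ≤ t₀) (hH : H ≤ t₀) :
    probRun ρ P alg T {ω | ∃ t : Fin T, t₀ ≤ t ∧
      P ∉ confidenceSet δ fun k : Fin t => ω (Fin.castLE t.2.le k)} ≤ δ / 2 := by
  refine (probRun_mono ρ P alg ?_).trans ((probRun_biUnion_le ρ P alg
    (Finset.univ.filter fun t : Fin T => t₀ ≤ t)
    fun t => {ω | P ∉ confidenceSet δ fun k : Fin t => ω (Fin.castLE t.2.le k)}).trans ?_)
  · rintro ω ⟨t, ht, h⟩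
    simp only [Set.mem_iUnion]
    exact ⟨t, by simpa using ht, h⟩
  · calc _ ≤ ∑ t ∈ Finset.univ.filter fun t : Fin T => t₀ ≤ t,
          δ / 2 * (1 / ((t : ℝ) + 1) ^ 2) := by
          refine Finset.sum_le_sum fun t ht => ?_
          have ht : t₀ ≤ t := by simpa using ht
          exact (probRun_notMem_confidenceSet_le ρ P alg t.2.le
            (one_le_card_mul_logFactor h0 h1 hS hA t)).trans
            (confidence_failure_bound h0 h1 hS hA (by omega))
      _ ≤ δ / 2 * ∑ t : Fin T, (if 1 ≤ (t : ℕ) then 1 / ((t : ℝ) + 1) ^ 2 else 0) := by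
          rw [Finset.sum_filter, Finset.mul_sum]
          refine Finset.sum_le_sum fun t _ => ?_
          by_cases h : t₀ ≤ (t : ℕ)
          · rw [if_pos h, if_pos (ht₀.trans h)]
          · rw [if_neg h]
            split_ifs <;> positivity
      _ ≤ δ / 2 := by
          refine mul_le_of_le_one_right (by positivity) ?_
          rw [Fin.sum_univ_eq_sum_range
            (fun t => if 1 ≤ t then 1 / ((t : ℝ) + 1) ^ 2 else 0) T]
          exact sum_one_div_sq_le T

end ConfidenceSets

section Pigeonhole

theorem div_sqrt_max_le {v N H : ℕ} (hv : v ≤ H) :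
    (v : ℝ) / Real.sqrt (max 1 N) ≤
      2 * Real.sqrt (2 * H) * (Real.sqrt ((N : ℝ) + v) - Real.sqrt N) := by
  have hm : 0 < Real.sqrt (max 1 (N : ℝ)) := Real.sqrt_pos.2 (by positivity)
  rcases Nat.eq_zero_or_pos v with rfl | hv0
  · simp
  have hH : (1 : ℝ) ≤ H := by exact_mod_cast hv0.trans_le hv
  have hv' : (v : ℝ) ≤ H := by exact_mod_cast hv
  rw [div_le_iff₀ hm]
  have hb : Real.sqrt ((N : ℝ) + v) ≤ Real.sqrt (2 * H) * Real.sqrt (max 1 N) := by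
    rw [← Real.sqrt_mul (by positivity)]
    refine Real.sqrt_le_sqrt ?_
    have h1 : (1 : ℝ) ≤ max 1 (N : ℝ) := le_max_left _ _
    have h2 : (N : ℝ) ≤ max 1 (N : ℝ) := le_max_right _ _
    nlinarith
  have hab : Real.sqrt N ≤ Real.sqrt ((N : ℝ) + v) := Real.sqrt_le_sqrt (by simp)
  have ha2 : Real.sqrt N ^ 2 = N := Real.sq_sqrt (by positivity)
  have hb2 : Real.sqrt ((N : ℝ) + v) ^ 2 = N + v := Real.sq_sqrt (by positivity)
  have h3 := mul_le_mul_of_nonneg_left hb (sub_nonneg.2 hab)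
  nlinarith [Real.sqrt_nonneg (N : ℝ), Real.sqrt_nonneg ((N : ℝ) + v)]

theorem sum_div_sqrt_max_le {H T : ℕ} (v : Fin T → ℕ) (hv : ∀ t, v t ≤ H) :
    ∑ t : Fin T, (v t : ℝ) /
        Real.sqrt (max 1 ((∑ k : Fin t, v (Fin.castLE t.2.le k) : ℕ) : ℝ)) ≤
      2 * Real.sqrt (2 * H) * Real.sqrt ((∑ t, v t : ℕ) : ℝ) := by
  induction T with
  | zero => simp
  | succ T ih =>
    specialize ih (fun t => v t.castSucc) fun t => hv _
    rw [Fin.sum_univ_castSucc, Fin.sum_univ_castSucc]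
    have h := div_sqrt_max_le (N := ∑ t : Fin T, v t.castSucc) (hv (Fin.last T))
    push_cast at h ih ⊢
    have h' : ∑ t : Fin T, (v t.castSucc : ℝ) /
        Real.sqrt (max 1 (∑ k : Fin t, (v (Fin.castLE t.castSucc.2.le k) : ℝ))) ≤
        2 * Real.sqrt (2 * H) * Real.sqrt (∑ t : Fin T, (v t.castSucc : ℝ)) := ih
    have h2 : (v (Fin.last T) : ℝ) /
        Real.sqrt (max 1 (∑ k : Fin T, (v (Fin.castLE (Fin.last T).2.le k) : ℝ))) ≤
        2 * Real.sqrt (2 * H) * (Real.sqrt (∑ t : Fin T, (v t.castSucc : ℝ) + v (Fin.last T)) -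
          Real.sqrt (∑ t : Fin T, (v t.castSucc : ℝ))) := h
    exact (add_le_add h' h2).trans (le_of_eq (by ring))

end Pigeonhole

section Transitions

variable {S A : Type*} {H T : ℕ}

theorem transitionSum_le_transitionSum {F G : S × A → S → ℝ} (h : ∀ z s, F z s ≤ G z s)
    (τ : Episode S A H) : transitionSum F τ ≤ transitionSum G τ := by
  refine Finset.sum_le_sum fun k _ => ?_
  split_ifs
  · exact h _ _
  · exact le_rfl

theorem transitionSum_mem_Icc {F : S × A → S → ℝ} {B : ℝ} (h : ∀ z s, F z s ∈ Set.Icc 0 B)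
    (hB : 0 ≤ B) (τ : Episode S A H) : transitionSum F τ ∈ Set.Icc 0 (B * H) := by
  constructor
  · refine Finset.sum_nonneg fun k _ => ?_
    split_ifs
    · exact (h _ _).1
    · exact le_rfl
  · calc transitionSum F τ ≤ ∑ _k : Fin H, B := Finset.sum_le_sum fun k _ => by
          split_ifs
          · exact (h _ _).2
          · exact hB
      _ = B * H := by simp [mul_comm]

variable [DecidableEq S] [DecidableEq A]

/-- The number of visits to a state-action pair in one episode, at time-steps other than the
last. -/
def episodeVisits (τ : Episode S A H) (z : S × A) : ℕ :=
  ∑ h : Fin H, if (h : ℕ) + 1 < H ∧ τ h = z then 1 else 0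

theorem visitCount_eq_sum_episodeVisits {t : ℕ} (hist : Fin t → Episode S A H) (z : S × A) :
    visitCount hist z.1 z.2 = ∑ k, episodeVisits (hist k) z := rfl

theorem episodeVisits_le (τ : Episode S A H) (z : S × A) : episodeVisits τ z ≤ H := by
  refine (Finset.sum_le_sum fun h _ => (show _ ≤ 1 by split_ifs <;> simp)).trans ?_
  simp

variable [Fintype S] [Fintype A]

theorem transitionSum_eq_sum_episodeVisits (D : S × A → ℝ) (τ : Episode S A H) :
    transitionSum (fun z _ => D z) τ = ∑ z, (episodeVisits τ z : ℝ) * D z := by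
  simp only [episodeVisits, Nat.cast_sum, Finset.sum_mul]
  rw [Finset.sum_comm]
  refine Finset.sum_congr rfl fun h _ => ?_
  by_cases h1 : (h : ℕ) + 1 < H <;> simp [h1]

theorem sum_episodeVisits_le (τ : Episode S A H) : ∑ z, episodeVisits τ z ≤ H := by
  simp only [episodeVisits]
  rw [Finset.sum_comm]
  calc _ ≤ ∑ _h : Fin H, 1 := Finset.sum_le_sum fun h _ => by
        by_cases h1 : (h : ℕ) + 1 < H <;> simp [h1]
    _ = H := by simp

theorem sum_sqrt_visits_le (ω : Fin T → Episode S A H) :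
    ∑ z, Real.sqrt ((∑ t, episodeVisits (ω t) z : ℕ) : ℝ) ≤
      Real.sqrt ((Fintype.card S : ℝ) * Fintype.card A * (T * H)) := by
  refine Real.le_sqrt_of_sq_le (sq_sum_le_card_mul_sum_sq.trans ?_)
  rw [Finset.card_univ, Fintype.card_prod]
  push_cast
  refine mul_le_mul_of_nonneg_left ?_ (by positivity)
  calc ∑ z : S × A, Real.sqrt (∑ t, (episodeVisits (ω t) z : ℝ)) ^ 2
      = ∑ z : S × A, ∑ t, (episodeVisits (ω t) z : ℝ) :=
        Finset.sum_congr rfl fun z _ => Real.sq_sqrt (by positivity)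
    _ = ∑ t, ((∑ z : S × A, episodeVisits (ω t) z : ℕ) : ℝ) := by
        rw [Finset.sum_comm]; push_cast; rfl
    _ ≤ ∑ _t : Fin T, (H : ℝ) := Finset.sum_le_sum fun t _ => by
        exact_mod_cast sum_episodeVisits_le (ω t)
    _ = T * H := by simp

theorem sum_confRadius_le {δ L : ℝ} (hL0 : 0 ≤ L) (hL : ∀ t < T, logFactor S A δ t ≤ L)
    (ω : Fin T → Episode S A H) :
    ∑ t : Fin T, transitionSum (fun z _ => min 2
        (2 * confRadius δ (fun k : Fin t => ω (Fin.castLE t.2.le k)) z)) (ω t) ≤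
      12 * (H * Fintype.card S * Real.sqrt (Fintype.card A * T) * Real.sqrt L) := by
  set K := Real.sqrt (4 * Fintype.card S * L) with hK
  have hrad : ∀ (t : Fin T) (z : S × A),
      min 2 (2 * confRadius δ (fun k : Fin t => ω (Fin.castLE t.2.le k)) z) ≤
      2 * K / Real.sqrt (max 1 ((∑ k : Fin t,
        episodeVisits (ω (Fin.castLE t.2.le k)) z : ℕ) : ℝ)) := by
    intro t z
    refine (min_le_right _ _).trans ?_
    rw [mul_div_assoc, hK, ← Real.sqrt_div (by positivity)]
    refine mul_le_mul_of_nonneg_left (Real.sqrt_le_sqrt ?_) two_pos.le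
    rw [visitCount_eq_sum_episodeVisits]
    have := hL t t.2
    gcongr
  calc _ ≤ ∑ t : Fin T, ∑ z, 2 * K * ((episodeVisits (ω t) z : ℝ) / Real.sqrt (max 1
          ((∑ k : Fin t, episodeVisits (ω (Fin.castLE t.2.le k)) z : ℕ) : ℝ))) := by
        refine Finset.sum_le_sum fun t _ => ?_
        rw [transitionSum_eq_sum_episodeVisits]
        refine Finset.sum_le_sum fun z _ => ?_
        refine (mul_le_mul_of_nonneg_left (hrad t z) (Nat.cast_nonneg _)).trans (le_of_eq ?_)
        ring
    _ = 2 * K * ∑ z, ∑ t : Fin T, ((episodeVisits (ω t) z : ℝ) / Real.sqrt (max 1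
          ((∑ k : Fin t, episodeVisits (ω (Fin.castLE t.2.le k)) z : ℕ) : ℝ))) := by
        rw [Finset.sum_comm]
        simp_rw [Finset.mul_sum]
    _ ≤ 2 * K * ∑ z, 2 * Real.sqrt (2 * H) *
          Real.sqrt ((∑ t, episodeVisits (ω t) z : ℕ) : ℝ) := by
        refine mul_le_mul_of_nonneg_left (Finset.sum_le_sum fun z _ => ?_) (by positivity)
        exact sum_div_sqrt_max_le (fun t => episodeVisits (ω t) z)
          fun t => episodeVisits_le (ω t) z
    _ ≤ 2 * K * (2 * Real.sqrt (2 * H) *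
          Real.sqrt ((Fintype.card S : ℝ) * Fintype.card A * (T * H))) := by
        rw [← Finset.mul_sum]
        gcongr
        exact sum_sqrt_visits_le ω
    _ = 8 * Real.sqrt 2 *
          (H * Fintype.card S * Real.sqrt (Fintype.card A * T) * Real.sqrt L) := by
        have h4 : Real.sqrt 4 = 2 := by
          rw [show (4 : ℝ) = 2 ^ 2 by norm_num, Real.sqrt_sq two_pos.le]
        have hS := Real.mul_self_sqrt (Nat.cast_nonneg (α := ℝ) (Fintype.card S))
        have hH := Real.mul_self_sqrt (Nat.cast_nonneg (α := ℝ) H)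
        rw [hK, Real.sqrt_mul (by positivity), Real.sqrt_mul (by positivity), h4,
          Real.sqrt_mul (by positivity), Real.sqrt_mul (by positivity),
          Real.sqrt_mul (by positivity), Real.sqrt_mul (by positivity),
          Real.sqrt_mul (by positivity)]
        nth_rw 3 [← hS]
        nth_rw 3 [← hH]
        ring
    _ ≤ _ := by
        gcongr
        have : Real.sqrt 2 ≤ 3 / 2 := Real.sqrt_le_iff.2 ⟨by norm_num, by norm_num⟩
        linarith

end Transitions

section Regret

variable {S A : Type*} [Fintype S] [Fintype A] [DecidableEq S] [DecidableEq A] {H n T : ℕ}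

theorem probRun_univ (ρ : stdSimplex ℝ S) (P : Transition S A) (alg : Planner S A H) :
    probRun ρ P alg T Set.univ = 1 := by
  simpa [probRun] using sum_runProb (T := T) ρ P alg

/-- The regret on a run whose confidence sets contain the true transition function from
episode `t₀` on. -/
theorem regret_le_of_mem_confidenceSet {ρ : stdSimplex ℝ S} {P : Transition S A}
    {r : Fin n → S → A → ℝ} (hr : ∀ i s a, r i s a ∈ Set.Icc (0 : ℝ) 1)
    (πstar : Policy S A H) {δ : ℝ} {alg : Planner S A H} (halg : IsUCRLNash ρ r δ alg)
    (hn : 0 < n) {t₀ : ℕ} {ω : Fin T → Episode S A H}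
    (hω : ∀ t : Fin T, t₀ ≤ t → P ∈ confidenceSet δ fun k : Fin t => ω (Fin.castLE t.2.le k)) :
    regret ρ r P πstar alg ω ≤ n * (H : ℝ) ^ n * (t₀ +
      ∑ t : Fin T, ∑ τ, episodeProb ρ P (playedPolicy alg ω t) τ *
        transitionSum (fun z _ => min 2
          (2 * confRadius δ (fun k : Fin t => ω (Fin.castLE t.2.le k)) z)) τ) := by
  have hn' : (1 : ℝ) ≤ n := by exact_mod_cast hn
  set G : Fin T → ℝ := fun t => ∑ τ, episodeProb ρ P (playedPolicy alg ω t) τ *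
    transitionSum (fun z _ => min 2
      (2 * confRadius δ (fun k : Fin t => ω (Fin.castLE t.2.le k)) z)) τ with hG
  have hG0 : ∀ t, 0 ≤ G t := fun t => Finset.sum_nonneg fun τ _ =>
    mul_nonneg (episodeProb_nonneg ρ P _ τ) (transitionSum_mem_Icc (B := 2)
      (fun z _ => ⟨le_min two_pos.le (mul_nonneg two_pos.le (Real.sqrt_nonneg _)),
        min_le_left _ _⟩) two_pos.le τ).1
  have hstep : ∀ t : Fin T,
      nashWelfare ρ r P πstar - nashWelfare ρ r P (playedPolicy alg ω t) ≤
        n * (H : ℝ) ^ n * ((if (t : ℕ) < t₀ then 1 else 0) + G t) := by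
    intro t
    by_cases ht : (t : ℕ) < t₀
    · have h1 := (nashWelfare_mem_Icc ρ hr P πstar).2
      have h2 := (nashWelfare_mem_Icc ρ hr P (playedPolicy alg ω t)).1
      have h3 : (1 : ℝ) * (H : ℝ) ^ n * 1 ≤ n * (H : ℝ) ^ n * (1 + G t) := by
        gcongr
        linarith [hG0 t]
      rw [if_pos ht]
      linarith
    · have hP := hω t (not_lt.1 ht)
      have h1 := nashWelfare_le_of_mem_confidenceSet hr halg hP πstar
      have h2 := nashWelfare_sub_le ρ hr P
        (alg t fun k : Fin t => ω (Fin.castLE t.2.le k)).1 (playedPolicy alg ω t)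
      rw [if_neg ht, zero_add]
      refine le_trans ?_ (h2.trans (mul_le_mul_of_nonneg_left
        (Finset.sum_le_sum fun τ _ => mul_le_mul_of_nonneg_left
          (transitionSum_le_transitionSum (fun z _ => ?_) τ) (episodeProb_nonneg ρ P _ τ))
        (by positivity)))
      · exact sub_le_sub_right h1 _
      · exact le_min (transitionDist_le_two P _ z)
          (transitionDist_le_of_mem hP (halg t _).1 z)
  refine (Finset.sum_le_sum fun t _ => hstep t).trans ?_
  rw [← Finset.mul_sum, Finset.sum_add_distrib]
  refine mul_le_mul_of_nonneg_left (add_le_add_left ?_ _) (by positivity)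
  rw [Fin.sum_univ_eq_sum_range (fun t => if t < t₀ then (1 : ℝ) else 0) T, ← Finset.sum_filter]
  rw [Finset.sum_const, nsmul_eq_mul, mul_one]
  have hsub : (Finset.range T).filter (· < t₀) ⊆ Finset.range t₀ := fun t ht => by
    simp only [Finset.mem_filter, Finset.mem_range] at ht ⊢
    exact ht.2
  have := Finset.card_le_card hsub
  rw [Finset.card_range] at this
  exact_mod_cast this

/-- The regret bound when there are at least two states. -/
theorem probRun_regret_le {ρ : stdSimplex ℝ S} {P : Transition S A}
    {r : Fin n → S → A → ℝ} (hr : ∀ i s a, r i s a ∈ Set.Icc (0 : ℝ) 1)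
    (πstar : Policy S A H) {δ : ℝ} (h0 : 0 < δ) (h1 : δ < 1) {alg : Planner S A H}
    (halg : IsUCRLNash ρ r δ alg) (hS : 2 ≤ Fintype.card S) (hA : 1 ≤ Fintype.card A)
    (hn : 0 < n) (hH : 0 < H) (hT : 0 < T) :
    1 - δ ≤ probRun ρ P alg T {ω | regret ρ r P πstar alg ω ≤ n * (H : ℝ) ^ n *
      (16 * (H * Fintype.card S * Real.sqrt (Fintype.card A * T) * Real.sqrt
        (Real.log ((Fintype.card S : ℝ) * Fintype.card A * T / δ))))} := by
  have hS' : (2 : ℝ) ≤ Fintype.card S := by exact_mod_cast hS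
  have hA' : (1 : ℝ) ≤ Fintype.card A := by exact_mod_cast hA
  have hH' : (1 : ℝ) ≤ H := by exact_mod_cast hH
  have hT' : (1 : ℝ) ≤ T := by exact_mod_cast hT
  set L := Real.log ((Fintype.card S : ℝ) * Fintype.card A * T / δ) with hL
  set R := H * Fintype.card S * Real.sqrt (Fintype.card A * T) * Real.sqrt L with hR
  have hSAT : (2 : ℝ) ≤ (Fintype.card S : ℝ) * Fintype.card A * T := by
    have : (2 : ℝ) * 1 * 1 ≤ (Fintype.card S : ℝ) * Fintype.card A * T := by gcongr
    linarith
  have hx : 2 / δ ≤ (Fintype.card S : ℝ) * Fintype.card A * T / δ := by gcongr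
  have hx2 : (2 : ℝ) ≤ 2 / δ := by
    rw [le_div_iff₀ h0]; linarith
  have hLlog : Real.log 2 ≤ L := Real.log_le_log two_pos (hx2.trans hx)
  have hLhalf : (1 / 2 : ℝ) ^ 2 ≤ L := by
    have := Real.log_two_gt_d9
    norm_num at this ⊢
    linarith
  have hL0 : 0 < L := lt_of_lt_of_le (by norm_num) hLhalf
  have hsqL : 1 / 2 ≤ Real.sqrt L := Real.le_sqrt_of_sq_le hLhalf
  have hsqAT : Real.sqrt T ≤ Real.sqrt (Fintype.card A * T) :=
    Real.sqrt_le_sqrt (by nlinarith)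
  have hsqT : 1 ≤ Real.sqrt T := Real.one_le_sqrt.2 hT'
  have hHR : (H : ℝ) ≤ R := by
    have : (H : ℝ) * 2 * 1 * (1 / 2) ≤ R := by
      rw [hR]
      gcongr
      exact hsqT.trans hsqAT
    linarith
  have hRpos : 0 < R := by linarith
  set t₀ := ⌈R⌉₊ with ht₀
  have ht₀R : (t₀ : ℝ) ≤ 2 * R := by
    have := Nat.ceil_lt_add_one hRpos.le
    linarith
  have hHt₀ : H ≤ t₀ := by exact_mod_cast hHR.trans (Nat.le_ceil R)
  set x : ℝ := H * Real.sqrt (2 * T * L) with hxdef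
  have hx0 : 0 < x := by positivity
  have hxR : x ≤ R := by
    have h2 : Real.sqrt 2 ≤ 2 := Real.sqrt_le_iff.2 ⟨by norm_num, by norm_num⟩
    have h3 : (H : ℝ) * 2 * Real.sqrt T * Real.sqrt L ≤ R := by
      rw [hR]; gcongr
    rw [hxdef, Real.sqrt_mul (by positivity), Real.sqrt_mul (by positivity)]
    refine le_trans ?_ h3
    rw [mul_assoc (H : ℝ) 2, mul_assoc (H : ℝ)]
    gcongr
  let f : (t : ℕ) → (Fin t → Episode S A H) → Episode S A H → ℝ := fun t u τ =>
    transitionSum (fun z _ => min 2 (2 * confRadius δ u z)) τ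
  have hf : ∀ t u τ, f t u τ ∈ Set.Icc 0 (2 * (H : ℝ)) := fun t u τ =>
    transitionSum_mem_Icc (fun z _ =>
      ⟨le_min two_pos.le (mul_nonneg two_pos.le (Real.sqrt_nonneg _)), min_le_left _ _⟩)
      two_pos.le τ
  set E₁ : Set (Fin T → Episode S A H) := {ω | ∃ t : Fin T, t₀ ≤ t ∧
    P ∉ confidenceSet δ fun k : Fin t => ω (Fin.castLE t.2.le k)} with hE₁
  set E₂ : Set (Fin T → Episode S A H) := {ω | x ≤ ∑ t : Fin T,
    ((∑ τ, episodeProb ρ P (playedPolicy alg ω t) τ *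
      f t (fun j : Fin t => ω (Fin.castLE t.2.le j)) τ) -
      f t (fun j : Fin t => ω (Fin.castLE t.2.le j)) (ω t))} with hE₂
  have hp₁ : probRun ρ P alg T E₁ ≤ δ / 2 :=
    probRun_exists_notMem_confidenceSet_le ρ P alg h0 h1 hS hA (hH.trans_le hHt₀) hHt₀
  have hp₂ : probRun ρ P alg T E₂ ≤ δ / 2 := by
    refine (probRun_azuma ρ P alg (by positivity) hT hf hx0).trans ?_
    have h2 : 2 * x ^ 2 / (T * (2 * (H : ℝ)) ^ 2) = L := by
      rw [hxdef, mul_pow, Real.sq_sqrt (by positivity)]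
      field_simp
    rw [h2, Real.exp_neg, hL, Real.exp_log (by positivity), inv_div]
    gcongr
  have hunion := probRun_union_le ρ P alg E₁ E₂
  have hcompl := probRun_add_compl ρ P alg (E₁ ∪ E₂)
  refine le_trans (by linarith) (probRun_mono ρ P alg (E := (E₁ ∪ E₂)ᶜ) ?_)
  intro ω hω
  rw [Set.compl_union] at hω
  obtain ⟨hω₁, hω₂⟩ := hω
  simp only [hE₁, hE₂, Set.mem_compl_iff, Set.mem_ofPred_eq, not_exists, not_and, not_not,
    not_le] at hω₁ hω₂
  refine (regret_le_of_mem_confidenceSet hr πstar halg hn hω₁).trans ?_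
  refine mul_le_mul_of_nonneg_left ?_ (by positivity)
  rw [Finset.sum_sub_distrib] at hω₂
  have hsum : ∑ t : Fin T, f t (fun j : Fin t => ω (Fin.castLE t.2.le j)) (ω t) ≤ 12 * R := by
    refine sum_confRadius_le hL0.le (fun t ht => ?_) ω
    have ht' : (t : ℝ) + 1 ≤ T := by exact_mod_cast ht
    refine Real.log_le_log (by positivity) ?_
    gcongr
  simp only [f] at hsum hω₂
  linarith

end Regret

end FairRL

open FairRL

theorem mainTheorem3 :
    ∃ C : ℝ, 0 < C ∧
      ∀ (S A : Type*) [Fintype S] [Fintype A] [DecidableEq S] [DecidableEq A]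
        (n H T : ℕ) (δ : ℝ), 0 < δ → δ < 1 →
      ∀ (ρ : stdSimplex ℝ S) (P : FairRL.Transition S A) (r : Fin n → S → A → ℝ),
        (∀ i s a, r i s a ∈ Set.Icc (0 : ℝ) 1) →
      ∀ πstar : FairRL.Policy S A H,
        IsMaxOn (fun π : FairRL.Policy S A H => FairRL.nashWelfare ρ r P π) Set.univ πstar →
      ∀ alg : FairRL.Planner S A H, FairRL.IsUCRLNash ρ r δ alg →
        1 - δ ≤ FairRL.probRun ρ P alg T
          {ω | FairRL.regret ρ r P πstar alg ω ≤
            C * (n : ℝ) * (H : ℝ) ^ (n + 1) * (Fintype.card S : ℝ) *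
              Real.sqrt ((Fintype.card A : ℝ) * (T : ℝ)) *
              Real.sqrt (Real.log
                ((Fintype.card S : ℝ) * (Fintype.card A : ℝ) * (T : ℝ) / δ))} := by
  refine ⟨16, by norm_num, ?_⟩
  intro S A _ _ _ _ n H T δ h0 h1 ρ P r hr πstar _ alg halg
  have hρ : Nonempty S := by
    by_contra hS
    rw [not_nonempty_iff] at hS
    simpa using ρ.2.2
  have hS1 : 1 ≤ Fintype.card S := Fintype.card_pos
  have trivial_case : (∀ ω : Fin T → Episode S A H, regret ρ r P πstar alg ω ≤ 0) →
      1 - δ ≤ probRun ρ P alg T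
          {ω | regret ρ r P πstar alg ω ≤
            16 * (n : ℝ) * (H : ℝ) ^ (n + 1) * (Fintype.card S : ℝ) *
              Real.sqrt ((Fintype.card A : ℝ) * (T : ℝ)) *
              Real.sqrt (Real.log
                ((Fintype.card S : ℝ) * (Fintype.card A : ℝ) * (T : ℝ) / δ))} := by
    intro h
    have h2 := probRun_univ (T := T) ρ P alg
    refine le_trans (by linarith) (h2.symm.le.trans (probRun_mono ρ P alg fun ω _ => ?_))
    exact (h ω).trans (by positivity)
  rcases Nat.eq_zero_or_pos n with rfl | hn
  · exact trivial_case fun ω => by simp [regret, nashWelfare]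
  rcases Nat.eq_zero_or_pos H with rfl | hH
  · exact trivial_case fun ω => Finset.sum_nonpos fun t _ => by
      rw [Subsingleton.elim πstar (playedPolicy alg ω t), sub_self]
  rcases Nat.eq_zero_or_pos T with rfl | hT
  · exact trivial_case fun ω => by simp [regret]
  rcases hS1.eq_or_lt with hS | hS
  · have hsub : Subsingleton S := Fintype.card_le_one_iff_subsingleton.1 hS.symm.le
    have hP : ∀ Q : Transition S A, Q = P := fun Q => by
      funext s a
      refine Subtype.ext (funext fun s' => ?_)
      have key : ∀ p : stdSimplex ℝ S, p.1 s' = 1 := fun p => by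
        rw [← p.2.2]
        exact (Fintype.sum_subsingleton p.1 s').symm
      rw [key, key]
    exact trivial_case fun ω => Finset.sum_nonpos fun t _ => by
      have h := (halg t fun k : Fin t => ω (Fin.castLE t.2.le k)).2.2 (Set.mem_univ πstar)
      rw [hP (alg t fun k : Fin t => ω (Fin.castLE t.2.le k)).1] at h
      exact sub_nonpos.2 h
  have hA : 1 ≤ Fintype.card A := by
    by_contra hA
    have : IsEmpty A := Fintype.card_eq_zero_iff.1 (by omega)
    have := (πstar ⟨0, hH⟩ hρ.some).2.2
    simp at this
  refine (probRun_regret_le (P := P) hr πstar h0 h1 halg hS hA hn hH hT).trans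
    (le_of_eq ?_)
  congr 1
  ext ω
  simp only [Set.mem_ofPred_eq]
  rw [pow_succ]
  constructor <;> intro h <;> refine h.trans (le_of_eq (by ring))
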